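/- Let $k$ be a field (of any characteristic), let $n\ge 1$, and let $1\le a_1<\cdots<a_n$ be integers with $\gcd(a_1,\dots,a_n)=1$. Let $R=k[\![x_1,\dots,x_n]\!]$ act by contraction on the divided power ring $\Gamma=k_{DP}[y_1,\dots,y_n]$: $x^\alpha\circ y^\beta=y^{\beta-\alpha}$ if $\alpha_i\le\beta_i$ for all $i$, and $x^\alpha\circ y^\beta=0$ otherwise. For an ideal $J\subseteq R$ let $J^\perp=\{F\in\Gamma \mid f\circ F=0 \text{ for all } f\in J\}$ be its inverse system. Let $I(a_1,\dots,a_n)$ be the kernel of the $k$-algebra homomorphism of power series rings $R\to k[\![t]\!]$ given by the substitution $x_i\mapsto t^{a_i}$. Let $\omega=(a_1,\dots,a_n)$, $\deg_\omega(K)=k_1a_1+\cdots+k_na_n$ for $K=(k_1,\dots,k_n)\in\mathbb N^n$, let $\mathcal J=\{\deg_\omega(K)\mid K\in\mathbb N^n\}$, and for $j\in\mathcal J$ put $$L_{\omega,j}=\sum_{\deg_\omega(K)=j}y^K .$$ Then for every integer $t\ge 1$, $$\bigl(I(a_1,\dots,a_n)+(x_1^t)\bigr)^\perp=\bigl\langle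 L_{\omega,j} \;\bigm|\; j\in\mathcal J,\ \deg_{y_1}(L_{\omega,j})\le t-1\bigr\rangle ,$$ where $\langle\cdots\rangle$ denotes the $R$-submodule of $\Gamma$ generated by the listed elements and $\deg_{y_1}$ is the degree in the variable $y_1$. -/

import Mathlib

noncomputable section

namespace SemigroupInverse

/-- The divided power ring `Γ = k_DP[y_1, …, y_n]` as a `k`-module: it is free on the (divided
power) monomials `y^K`, `K ∈ ℕⁿ`, and `F : DPRing k n` has `F K` as its coefficient at `y^K`.
Only the module structure of `Γ` (over `k` and, by contraction, over `k⟦x_1, …, x_n⟧`) is needed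
for inverse systems, so the product of `Γ` is not introduced. -/
def DPRing (k : Type*) [Field k] (n : ℕ) : Type _ := (Fin n →₀ ℕ) →₀ k

variable {k : Type*} [Field k] {n : ℕ}

instance : AddCommGroup (DPRing k n) :=
  inferInstanceAs (AddCommGroup ((Fin n →₀ ℕ) →₀ k))

instance : Module k (DPRing k n) :=
  inferInstanceAs (Module k ((Fin n →₀ ℕ) →₀ k))

/-- The monomial `y^K` of `Γ`. -/
def DPRing.mono (k : Type*) [Field k] {n : ℕ} (K : Fin n →₀ ℕ) : DPRing k n :=
  (Finsupp.single K 1 : (Fin n →₀ ℕ) →₀ k)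

/-- The set of exponents `K` of the monomials `y^K` that occur in `F` with nonzero coefficient. -/
def DPRing.support (F : DPRing k n) : Finset (Fin n →₀ ℕ) :=
  Finsupp.support (F : (Fin n →₀ ℕ) →₀ k)

/-- The degree of `F ∈ Γ` in the variable `y_i`: the largest exponent of `y_i` in a monomial of
`F` (and `0` for `F = 0`). -/
def DPRing.degreeIn (i : Fin n) (F : DPRing k n) : ℕ :=
  F.support.sup fun K => K i

/-- Contraction of the monomial `y^β` by a power series `f = ∑ f_α x^α`: the finite sum of the
`f_α y^(β - α)` over all `α ≤ β`, that is, over all pairs `(α, γ)` with `α + γ = β`. -/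
def contractMono (f : MvPowerSeries (Fin n) k) (β : Fin n →₀ ℕ) : DPRing k n :=
  ∑ p ∈ Finset.HasAntidiagonal.antidiagonal β, MvPowerSeries.coeff p.1 f • DPRing.mono k p.2

/-- Contraction `F ↦ f ∘ F` by a power series `f`: the `k`-linear extension of `contractMono`. -/
def contract (f : MvPowerSeries (Fin n) k) : DPRing k n →ₗ[k] DPRing k n :=
  Finsupp.linearCombination k (contractMono f)

theorem contract_mono (f : MvPowerSeries (Fin n) k) (β : Fin n →₀ ℕ) :
    contract f (DPRing.mono k β) = contractMono f β :=
  (Finsupp.linearCombination_single k (1 : k) β).trans (one_smul k _)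

theorem DPRing.hom_ext {φ ψ : DPRing k n →ₗ[k] DPRing k n}
    (h : ∀ β, φ (DPRing.mono k β) = ψ (DPRing.mono k β)) : φ = ψ :=
  Finsupp.lhom_ext' fun β => LinearMap.ext_ring (h β)

theorem contract_mul (f g : MvPowerSeries (Fin n) k) :
    contract (f * g) = contract f ∘ₗ contract g := by
  refine DPRing.hom_ext fun β => ?_
  rw [LinearMap.comp_apply, contract_mono, contract_mono]
  simp only [contractMono, map_sum, map_smul, contract_mono, MvPowerSeries.coeff_mul,
    Finset.sum_smul, Finset.smul_sum, smul_smul]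
  rw [Finset.sum_sigma', Finset.sum_sigma']
  refine Finset.sum_nbij' (fun x => ⟨(x.2.2, x.2.1 + x.1.2), (x.2.1, x.1.2)⟩)
    (fun x => ⟨(x.2.1 + x.1.1, x.2.2), (x.2.1, x.1.1)⟩) ?_ ?_ ?_ ?_ ?_
  · rintro ⟨⟨a, b⟩, ⟨c, d⟩⟩ h
    simp only [Finset.mem_sigma, Finset.HasAntidiagonal.mem_antidiagonal] at h ⊢
    obtain ⟨rfl, rfl⟩ := h
    exact ⟨by abel, trivial⟩
  · rintro ⟨⟨a, b⟩, ⟨c, d⟩⟩ h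
    simp only [Finset.mem_sigma, Finset.HasAntidiagonal.mem_antidiagonal] at h ⊢
    obtain ⟨rfl, rfl⟩ := h
    exact ⟨by abel, trivial⟩
  · rintro ⟨⟨a, b⟩, ⟨c, d⟩⟩ h
    simp only [Finset.mem_sigma, Finset.HasAntidiagonal.mem_antidiagonal] at h
    obtain ⟨rfl, rfl⟩ := h
    rfl
  · rintro ⟨⟨a, b⟩, ⟨c, d⟩⟩ h
    simp only [Finset.mem_sigma, Finset.HasAntidiagonal.mem_antidiagonal] at h
    obtain ⟨rfl, rfl⟩ := h
    rfl
  · rintro ⟨⟨a, b⟩, ⟨c, d⟩⟩ _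
    simp only [mul_comm]

theorem contract_one : contract (1 : MvPowerSeries (Fin n) k) = LinearMap.id := by
  classical
  refine DPRing.hom_ext fun β => ?_
  rw [contract_mono, contractMono, Finset.sum_eq_single (0, β)]
  · simp
  · rintro ⟨a, b⟩ h hne
    rw [Finset.HasAntidiagonal.mem_antidiagonal] at h
    have ha : a ≠ 0 := by
      rintro rfl
      exact hne (by rw [← h]; simp)
    simp [MvPowerSeries.coeff_one, ha]
  · intro h
    exact absurd (Finset.HasAntidiagonal.mem_antidiagonal.2 (zero_add β)) h

theorem contract_zero : contract (0 : MvPowerSeries (Fin n) k) = 0 :=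
  DPRing.hom_ext fun β => by rw [contract_mono]; simp [contractMono]

theorem contract_add (f g : MvPowerSeries (Fin n) k) :
    contract (f + g) = contract f + contract g :=
  DPRing.hom_ext fun β => by
    rw [LinearMap.add_apply, contract_mono, contract_mono, contract_mono]
    simp [contractMono, add_smul, Finset.sum_add_distrib]

/-- The action of `R = k⟦x_1, …, x_n⟧` on `Γ` by contraction, as a ring homomorphism. -/
def contractHom (k : Type*) [Field k] (n : ℕ) :
    MvPowerSeries (Fin n) k →+* Module.End k (DPRing k n) where
  toFun := contract
  map_one' := contract_one
  map_mul' := contract_mul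
  map_zero' := contract_zero
  map_add' := contract_add

/-- `Γ` is an `R`-module by contraction: `f • F = f ∘ F`. -/
instance : Module (MvPowerSeries (Fin n) k) (DPRing k n) :=
  Module.compHom (DPRing k n) (contractHom k n)

/-- Macaulay's inverse system `I^⊥ = {F ∈ Γ | I ∘ F = 0}`, an `R`-submodule of `Γ`. -/
def inverseSystem (I : Ideal (MvPowerSeries (Fin n) k)) :
    Submodule (MvPowerSeries (Fin n) k) (DPRing k n) where
  carrier := {F | ∀ f ∈ I, f • F = 0}
  zero_mem' := fun f _ => smul_zero f
  add_mem' := fun {F G} hF hG f hf => by rw [smul_add, hF f hf, hG f hf, add_zero]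
  smul_mem' := fun g F hF f hf => by rw [smul_comm, hF f hf, smul_zero]

theorem hasSubst_curve (k : Type*) [Field k] (a : Fin n → ℕ) (ha : ∀ i, 1 ≤ a i) :
    MvPowerSeries.HasSubst fun i => (PowerSeries.X ^ a i : PowerSeries k) :=
  MvPowerSeries.hasSubst_of_constantCoeff_zero fun i => by
    have h : a i ≠ 0 := Nat.one_le_iff_ne_zero.1 (ha i)
    change PowerSeries.constantCoeff (PowerSeries.X ^ a i : PowerSeries k) = 0
    simp [h]

/-- The parametrization `φ : k⟦x_1, …, x_n⟧ → k⟦t⟧`, `x_i ↦ t^(a_i)`, of the monomial curve. -/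
def curveHom (k : Type*) [Field k] (a : Fin n → ℕ) (ha : ∀ i, 1 ≤ a i) :
    MvPowerSeries (Fin n) k →ₐ[k] PowerSeries k :=
  MvPowerSeries.substAlgHom (hasSubst_curve k a ha)

/-- The ideal `I(a_1, …, a_n) = ker φ`. -/
def curveIdeal (k : Type*) [Field k] (a : Fin n → ℕ) (ha : ∀ i, 1 ≤ a i) :
    Ideal (MvPowerSeries (Fin n) k) :=
  RingHom.ker (curveHom k a ha)

/-- The set of weighted degrees `deg_ω(K) = k_1 a_1 + ⋯ + k_n a_n` of exponents `K ∈ ℕⁿ`. -/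
def weightSet (a : Fin n → ℕ) : Set ℕ := {j | ∃ K : Fin n →₀ ℕ, Finsupp.weight a K = j}

theorem finite_weight_eq (a : Fin n → ℕ) (ha : ∀ i, 1 ≤ a i) (j : ℕ) :
    {K : Fin n →₀ ℕ | Finsupp.weight a K = j}.Finite :=
  Finsupp.finite_of_nat_weight_eq a (fun i => Nat.one_le_iff_ne_zero.1 (ha i)) j

/-- The form `L_{ω,j}`: the sum of all monomials `y^K` with `deg_ω(K) = j`. -/
def weightForm (k : Type*) [Field k] (a : Fin n → ℕ) (ha : ∀ i, 1 ≤ a i) (j : ℕ) :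
    DPRing k n :=
  ∑ K ∈ (finite_weight_eq a ha j).toFinset, DPRing.mono k K

end SemigroupInverse

end

/-! Contracting by `x^α` shifts coefficients by `α`. Binomials `x^α - x^β` with `α`, `β` of equal
weight lie in the curve ideal, so any `F` it kills has coefficients depending only on the weight:
`F` is a finite `k`-combination of the `L_{ω,j}`. Conversely, the coefficients of `f ∘ L_{ω,j}` are
coefficients of `φ(f)`, so the curve ideal kills every `L_{ω,j}`. Being killed by `x_1^t` only
bounds the degree in `y_1`, and this bound passes from `F` to each form in it, since weight classes
share one coefficient and so cannot cancel. -/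

noncomputable section

namespace SemigroupInverse

variable {k : Type*} [Field k] {n : ℕ}

namespace DPRing

/-- The coefficient of `y^K`, as a linear form on `Γ`. -/
def coeff (k : Type*) [Field k] {n : ℕ} (K : Fin n →₀ ℕ) : DPRing k n →ₗ[k] k :=
  (Finsupp.lapply K : ((Fin n →₀ ℕ) →₀ k) →ₗ[k] k)

@[ext]
theorem ext_coeff {F G : DPRing k n} (h : ∀ K, coeff k K F = coeff k K G) : F = G :=
  Finsupp.ext h

theorem coeff_mono [DecidableEq (Fin n →₀ ℕ)] (K β : Fin n →₀ ℕ) :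
    coeff k K (mono k β) = if β = K then 1 else 0 :=
  Finsupp.single_apply

theorem mem_support {F : DPRing k n} {K : Fin n →₀ ℕ} : K ∈ F.support ↔ coeff k K F ≠ 0 :=
  Finsupp.mem_support_iff

theorem degreeIn_le_iff {i : Fin n} {F : DPRing k n} {d : ℕ} :
    F.degreeIn i ≤ d ↔ ∀ K, coeff k K F ≠ 0 → K i ≤ d := by
  simp only [degreeIn, Finset.sup_le_iff, mem_support]

end DPRing

open DPRing

theorem coeff_contractMono (f : MvPowerSeries (Fin n) k) (β γ : Fin n →₀ ℕ) :
    coeff k γ (contractMono f β) =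
      ∑ p ∈ Finset.HasAntidiagonal.antidiagonal β with p.2 = γ, MvPowerSeries.coeff p.1 f := by
  classical
  rw [contractMono, map_sum, Finset.sum_filter]
  refine Finset.sum_congr rfl fun p _ => ?_
  rw [map_smul, coeff_mono]
  split_ifs <;> simp

theorem smul_eq_contract (f : MvPowerSeries (Fin n) k) (F : DPRing k n) :
    f • F = contract f F := rfl

theorem coeff_monomial_smul (α γ : Fin n →₀ ℕ) (c : k) (F : DPRing k n) :
    coeff k γ (MvPowerSeries.monomial α c • F) = c * coeff k (α + γ) F := by
  classical
  have h : coeff k γ ∘ₗ contract (MvPowerSeries.monomial α c) = c • coeff k (α + γ) := by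
    refine Finsupp.lhom_ext' fun β => LinearMap.ext_ring ?_
    change coeff k γ (contract _ (mono k β)) = c * coeff k (α + γ) (mono k β)
    rw [contract_mono, coeff_contractMono, coeff_mono]
    simp only [MvPowerSeries.coeff_monomial]
    rw [← Finset.sum_filter, Finset.filter_filter, Finset.sum_const]
    have : Finset.filter (fun p : (Fin n →₀ ℕ) × (Fin n →₀ ℕ) => p.2 = γ ∧ p.1 = α)
        (Finset.HasAntidiagonal.antidiagonal β) = if β = α + γ then {(α, γ)} else ∅ := by
      ext ⟨p, q⟩
      split_ifs with hβ
      · simp only [Finset.mem_filter, Finset.HasAntidiagonal.mem_antidiagonal,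
          Finset.mem_singleton, Prod.mk.injEq]
        constructor
        · rintro ⟨_, rfl, rfl⟩
          exact ⟨rfl, rfl⟩
        · rintro ⟨rfl, rfl⟩
          exact ⟨hβ.symm, rfl, rfl⟩
      · simp only [Finset.mem_filter, Finset.HasAntidiagonal.mem_antidiagonal,
          Finset.notMem_empty, iff_false]
        rintro ⟨h, rfl, rfl⟩
        exact hβ h.symm
    rw [this]
    split_ifs <;> simp
  exact LinearMap.congr_fun h F

theorem C_smul (c : k) (F : DPRing k n) :
    (MvPowerSeries.C c : MvPowerSeries (Fin n) k) • F = c • F := by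
  ext K
  rw [← MvPowerSeries.monomial_zero_eq_C_apply, coeff_monomial_smul, zero_add, map_smul, smul_eq_mul]

/-- Scalars of `k` act as constant power series, so an `R`-span is closed under them. -/
theorem smul_mem_span {s : Set (DPRing k n)} (c : k) {F : DPRing k n}
    (hF : F ∈ Submodule.span (MvPowerSeries (Fin n) k) s) :
    c • F ∈ Submodule.span (MvPowerSeries (Fin n) k) s := by
  rw [← C_smul]
  exact Submodule.smul_mem _ _ hF

theorem mem_inverseSystem {I : Ideal (MvPowerSeries (Fin n) k)} {F : DPRing k n} :
    F ∈ inverseSystem I ↔ ∀ f ∈ I, f • F = 0 := Iff.rfl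

theorem mem_inverseSystem_sup_span_singleton {I : Ideal (MvPowerSeries (Fin n) k)}
    {g : MvPowerSeries (Fin n) k} {F : DPRing k n} :
    F ∈ inverseSystem (I ⊔ Ideal.span {g}) ↔ F ∈ inverseSystem I ∧ g • F = 0 := by
  simp only [mem_inverseSystem]
  constructor
  · exact fun h => ⟨fun f hf => h f (Ideal.mem_sup_left hf),
      h g (Ideal.mem_sup_right (Ideal.mem_span_singleton_self g))⟩
  · rintro ⟨hI, hg⟩ f hf
    obtain ⟨u, hu, v, hv, rfl⟩ := Submodule.mem_sup.1 hf
    obtain ⟨w, rfl⟩ := Ideal.mem_span_singleton'.1 hv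
    rw [add_smul, hI u hu, mul_smul, hg, smul_zero, add_zero]

theorem X_pow_smul_eq_zero_iff {i : Fin n} {t : ℕ} {F : DPRing k n} (ht : 1 ≤ t) :
    (MvPowerSeries.X i : MvPowerSeries (Fin n) k) ^ t • F = 0 ↔ F.degreeIn i ≤ t - 1 := by
  rw [MvPowerSeries.X_pow_eq, degreeIn_le_iff]
  constructor
  -- A monomial with exponent at least `t` in `y_i` survives contraction by `x_i^t`; `1 ≤ t` keeps
  -- the truncated `t - 1` honest.
  · intro h K hK
    by_contra! hlt
    have hle : Finsupp.single i t ≤ K := Finsupp.single_le_iff.2 (by omega)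
    refine hK ?_
    rw [← add_tsub_cancel_of_le hle, ← one_mul (coeff k _ F), ← coeff_monomial_smul, h, map_zero]
  · intro h
    ext K
    rw [coeff_monomial_smul, one_mul, map_zero]
    by_contra hK
    have := h _ hK
    rw [Finsupp.add_apply, Finsupp.single_eq_same] at this
    omega

section Curve

variable (a : Fin n → ℕ) (ha : ∀ i, 1 ≤ a i)

theorem coeff_weightForm (j : ℕ) (K : Fin n →₀ ℕ) :
    coeff k K (weightForm k a ha j) = if Finsupp.weight a K = j then 1 else 0 := by
  classical
  rw [weightForm, map_sum]
  simp [coeff_mono]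

/-- Since `φ(x^K) = t^(deg_ω K)`, the coefficient collects one weight class, finite because all `a i
≥ 1`. -/
theorem coeff_curveHom (f : MvPowerSeries (Fin n) k) (m : ℕ) :
    PowerSeries.coeff m (curveHom k a ha f) =
      ∑ K ∈ (finite_weight_eq a ha m).toFinset, MvPowerSeries.coeff K f := by
  classical
  have h : ∀ d : Fin n →₀ ℕ, (d.prod fun i e => (PowerSeries.X ^ a i : PowerSeries k) ^ e) =
      PowerSeries.X ^ Finsupp.weight a d := fun d => by
    rw [Finsupp.weight_apply, Finsupp.prod, Finsupp.sum, ← Finset.prod_pow_eq_pow_sum]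
    exact Finset.prod_congr rfl fun i _ => by rw [← pow_mul, smul_eq_mul, mul_comm]
  rw [curveHom, MvPowerSeries.coe_substAlgHom, PowerSeries.coeff,
    MvPowerSeries.coeff_subst (hasSubst_curve k a ha)]
  simp only [h]
  change ∑ᶠ d, MvPowerSeries.coeff d f •
    PowerSeries.coeff m (PowerSeries.X ^ Finsupp.weight a d) = _
  rw [finsum_eq_sum_of_support_subset]
  · refine Finset.sum_congr rfl fun d hd => ?_
    have hd' : Finsupp.weight a d = m := by simpa using hd
    rw [hd', PowerSeries.coeff_X_pow_self, smul_eq_mul, mul_one]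
  · intro d hd
    rw [Function.mem_support, PowerSeries.coeff_X_pow] at hd
    by_contra hne
    refine hd ?_
    rw [if_neg fun hm => hne (by simpa using hm.symm), smul_zero]

theorem coeff_smul_weightForm (f : MvPowerSeries (Fin n) k) (j : ℕ) (γ : Fin n →₀ ℕ) :
    coeff k γ (f • weightForm k a ha j) =
      if Finsupp.weight a γ ≤ j then
        PowerSeries.coeff (j - Finsupp.weight a γ) (curveHom k a ha f) else 0 := by
  classical
  rw [smul_eq_contract, weightForm, map_sum, map_sum]
  simp only [contract_mono, coeff_contractMono]
  rw [Finset.sum_sigma']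
  split_ifs with hle
  · rw [coeff_curveHom]
    -- With `γ` fixed, `K = α + γ` has weight `j` exactly when `α` has weight `j - deg_ω γ`.
    refine Finset.sum_nbij' (fun x => x.2.1) (fun α => ⟨α + γ, (α, γ)⟩) ?_ ?_ ?_ ?_ ?_
    · rintro ⟨K, α, δ⟩ h
      simp only [Finset.mem_sigma, Set.Finite.mem_toFinset, Set.mem_ofPred_eq, Finset.mem_filter,
        Finset.HasAntidiagonal.mem_antidiagonal] at h ⊢
      obtain ⟨rfl, rfl, rfl⟩ := h
      rw [map_add, Nat.add_sub_cancel]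
    · intro α h
      simp only [Finset.mem_sigma, Set.Finite.mem_toFinset, Set.mem_ofPred_eq, Finset.mem_filter,
        Finset.HasAntidiagonal.mem_antidiagonal] at h ⊢
      refine ⟨?_, trivial, trivial⟩
      rw [map_add]
      omega
    · rintro ⟨K, α, δ⟩ h
      simp only [Finset.mem_sigma, Set.Finite.mem_toFinset, Set.mem_ofPred_eq, Finset.mem_filter,
        Finset.HasAntidiagonal.mem_antidiagonal] at h ⊢
      obtain ⟨-, rfl, rfl⟩ := h
      rfl
    · exact fun _ _ => rfl
    · exact fun _ _ => rfl
  · refine Finset.sum_eq_zero ?_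
    rintro ⟨K, α, δ⟩ h
    simp only [Finset.mem_sigma, Set.Finite.mem_toFinset, Set.mem_ofPred_eq, Finset.mem_filter,
      Finset.HasAntidiagonal.mem_antidiagonal] at h
    obtain ⟨rfl, rfl, rfl⟩ := h
    exact absurd (by rw [map_add]; omega) hle

theorem weightForm_mem_inverseSystem (j : ℕ) :
    weightForm k a ha j ∈ inverseSystem (curveIdeal k a ha) := by
  intro f hf
  have hf0 : curveHom k a ha f = 0 := hf
  ext γ
  rw [coeff_smul_weightForm, hf0]
  simp

theorem monomial_sub_monomial_mem_curveIdeal {α β : Fin n →₀ ℕ}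
    (h : Finsupp.weight a α = Finsupp.weight a β) :
    (MvPowerSeries.monomial α (1 : k) - MvPowerSeries.monomial β 1) ∈ curveIdeal k a ha := by
  classical
  change curveHom k a ha _ = 0
  ext m
  rw [map_sub, map_sub, coeff_curveHom, coeff_curveHom]
  simp [MvPowerSeries.coeff_monomial, h]

theorem coeff_eq_of_weight_eq {F : DPRing k n} (hF : F ∈ inverseSystem (curveIdeal k a ha))
    {α β : Fin n →₀ ℕ} (h : Finsupp.weight a α = Finsupp.weight a β) :
    coeff k α F = coeff k β F := by
  -- The coefficient of `x^α ∘ F` at `y^0` is that of `F` at `y^α`.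
  have h0 := congrArg (coeff k 0) (hF _ (monomial_sub_monomial_mem_curveIdeal a ha h))
  rw [sub_smul, map_sub, coeff_monomial_smul, coeff_monomial_smul, map_zero] at h0
  simpa [sub_eq_zero] using h0

theorem eq_sum_weightForm {F : DPRing k n} (hF : F ∈ inverseSystem (curveIdeal k a ha)) :
    ∃ c : ℕ → k, (∀ K, c (Finsupp.weight a K) = coeff k K F) ∧
      F = ∑ j ∈ F.support.image (Finsupp.weight a), c j • weightForm k a ha j := by
  classical
  -- `c j` is the common coefficient on weight `j`; the default `0` is never used.
  let c : ℕ → k := fun j => if h : ∃ K, Finsupp.weight a K = j then coeff k h.choose F else 0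
  have hc : ∀ K, c (Finsupp.weight a K) = coeff k K F := fun K => by
    have h : ∃ K', Finsupp.weight a K' = Finsupp.weight a K := ⟨K, rfl⟩
    rw [show c (Finsupp.weight a K) = coeff k h.choose F from dif_pos h]
    exact coeff_eq_of_weight_eq a ha hF h.choose_spec
  refine ⟨c, hc, DPRing.ext_coeff fun K => ?_⟩
  simp only [map_sum, map_smul, coeff_weightForm, smul_eq_mul, mul_ite, mul_one, mul_zero,
    Finset.sum_ite_eq, hc]
  split_ifs with hK
  · rfl
  · by_contra hne
    exact hK (Finset.mem_image_of_mem _ (mem_support.2 hne))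

end Curve

end SemigroupInverse

end

theorem corollary4p2 {k : Type*} [Field k] {n : ℕ} (a : Fin (n + 1) → ℕ)
    (ha : ∀ i, 1 ≤ a i) (hmono : StrictMono a) (hgcd : Finset.univ.gcd a = 1)
    (t : ℕ) (ht : 1 ≤ t) :
    SemigroupInverse.inverseSystem
        (SemigroupInverse.curveIdeal k a ha ⊔
          Ideal.span {(MvPowerSeries.X 0 : MvPowerSeries (Fin (n + 1)) k) ^ t}) =
      Submodule.span (MvPowerSeries (Fin (n + 1)) k)
        {F | ∃ j ∈ SemigroupInverse.weightSet a,
          (SemigroupInverse.weightForm k a ha j).degreeIn 0 ≤ t - 1 ∧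
            F = SemigroupInverse.weightForm k a ha j} := by
  open SemigroupInverse in
  apply le_antisymm
  · intro F hF
    obtain ⟨hI, hX⟩ := mem_inverseSystem_sup_span_singleton.1 hF
    rw [X_pow_smul_eq_zero_iff ht, DPRing.degreeIn_le_iff] at hX
    obtain ⟨c, hc, hsum⟩ := eq_sum_weightForm a ha hI
    rw [hsum]
    refine Submodule.sum_mem _ fun j hj => smul_mem_span _ (Submodule.subset_span ?_)
    obtain ⟨K, hK, rfl⟩ := Finset.mem_image.1 hj
    -- Every `K'` in the form has the weight of `K`, hence the same nonzero coefficient in `F`, so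
    -- the bound for `F` applies to it.
    refine ⟨_, ⟨K, rfl⟩, DPRing.degreeIn_le_iff.2 fun K' hK' => hX K' ?_, rfl⟩
    rw [coeff_weightForm, ne_eq, ite_eq_right_iff, Classical.not_imp] at hK'
    rw [← hc, hK'.1, hc]
    exact DPRing.mem_support.1 hK
  · rw [Submodule.span_le]
    rintro F ⟨j, -, hj, rfl⟩
    exact mem_inverseSystem_sup_span_singleton.2
      ⟨weightForm_mem_inverseSystem a ha j, (X_pow_smul_eq_zero_iff ht).2 hj⟩
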